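/- Let $S$ be a closed connected orientable surface of genus $g>1$ endowed with a Riemannian metric, let $f\colon S\to S$ be a homeomorphism, and let $\mathcal I=(f_t)_{t\in[0,1]}$ be an isotopy from $f_0=\mathrm{Id}$ to $f_1=f$ (a continuous family of homeomorphisms). Fix a point $b\in S$ and a family of rectifiable arcs $\gamma_x$ ($x\in S$) from $b$ to $x$ whose lengths are bounded by a uniform constant. Let $\Phi_f(x)=[\gamma_x*\mathcal I_x*\gamma_{f(x)}^{-1}]\in H_1(S,\mathbb R)$, where $\mathcal I_x$ is the arc $t\mapsto f_t(x)$, and let $\Phi_f^n(x)=\sum_{k=0}^{n-1}\Phi_f(f^k(x))$. Endow $H_1(S,\mathbb R)$ with the stable norm $\|h\|=\inf\{\sum_i|r_i|\operatorname{length}(\gamma_i)\}$, the infimum being over all finite real combinations of rectifiable loops with $\sum_i r_i[\gamma_i]=h$; for $E\subset H_1(S,\mathbb R)$ let $B_r(E)=\{w:\|v-w\|<r\text{ for some }v\in E\}$. For $E\subset S$, let the rotation set $\rho_{\mathrm{mz}}(f,E)$ be the set of all limits $\lim_{k\to\infty}\frac1{n_k}\Phi_f^{n_k}(x_k)$ with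 $x_k\in E$ and $n_k\to\infty$, and let $\rho_{\mathrm{mz}}(f)=\rho_{\mathrm{mz}}(f,S)$. Call a set $E\subset S$ inessential if it has an open neighborhood $W$ such that every loop in $W$ is homotopically trivial in $S$, and fully essential if $S\setminus E$ is inessential. Let $\mathcal C(f)$ be the set of all $z\in S$ such that $\bigcup_{n\in\mathbb Z}f^n(V)$ is fully essential for every neighborhood $V$ of $z$. If $z\in\mathcal C(f)$, then for any neighborhood $U$ of $z$ there exists $r>0$ such that $$\{\Phi_f^n(x):x\in S\}\subset B_r(\{\Phi_f^n(y):y\in U\})\quad\text{for all } n\in\mathbb N.$$ In particular, $\rho_{\mathrm{mz}}(f,U)=\rho_{\mathrm{mz}}(f)$. -/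

import Mathlib

open Set Filter Topology unitInterval Bundle
open scoped Manifold ContDiff ENNReal NNReal

universe u

noncomputable section

namespace SurfaceRotation

/-! ### Orientability -/

/-- A smooth surface is orientable if it is covered by smooth charts (members of the maximal
smooth atlas) all of whose coordinate changes have positive Jacobian determinant. -/
def IsOrientable (S : Type u) [TopologicalSpace S] [ChartedSpace (EuclideanSpace ℝ (Fin 2)) S] :
    Prop :=
  ∃ A ⊆ IsManifold.maximalAtlas (𝓡 2) ∞ S,
    (∀ x : S, ∃ e ∈ A, x ∈ e.source) ∧
    ∀ e ∈ A, ∀ e' ∈ A, ∀ p ∈ (e.symm.trans e').source,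
      0 < (fderiv ℝ (fun q => e' (e.symm q)) p).det

/-! ### Singular homology in degree one and classes of loops -/

section Homology

open CategoryTheory AlgebraicTopology

/-- The singular chain complex of `S` with real coefficients. -/
abbrev singularChains (S : Type u) [TopologicalSpace S] : ChainComplex (ModuleCat.{u} ℝ) ℕ :=
  ((singularChainComplexFunctor (ModuleCat.{u} ℝ)).obj (ModuleCat.of ℝ (ULift.{u} ℝ))).obj
    (TopCat.of S)

/-- `H₁(S, ℝ)`: first singular homology with real coefficients, an object of `ModuleCat ℝ`. -/
abbrev H1 (S : Type u) [TopologicalSpace S] : ModuleCat.{u} ℝ :=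
  ((singularHomologyFunctor (ModuleCat.{u} ℝ) 1).obj (ModuleCat.of ℝ (ULift.{u} ℝ))).obj
    (TopCat.of S)

variable {S : Type u} [TopologicalSpace S]

/-- A path, as a singular `1`-simplex. -/
def pathSimplex {x y : S} (γ : Path x y) :
    (TopCat.toSSet.obj (TopCat.of S)).obj (Opposite.op (SimplexCategory.mk 1)) :=
  (TopCat.toSSetObjEquiv (TopCat.of S) _).symm
    (γ.toContinuousMap.comp ⟨_, stdSimplexHomeomorphUnitInterval.continuous⟩)

/-- The singular `1`-chain `t ↦ t • γ` carried by a path `γ`. -/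
def pathChain {x y : S} (γ : Path x y) :
    ModuleCat.of ℝ (ULift.{u} ℝ) ⟶ (singularChains S).X 1 :=
  (TopCat.toSSet.obj (TopCat.of S)).ιChainComplex (pathSimplex γ)

/-- The chain carried by a loop is a cycle. -/
theorem pathChain_d {x : S} (γ : Path x x) : pathChain γ ≫ (singularChains S).d 1 0 = 0 := by
  have hf : (TopCat.toSSet.obj (TopCat.of S)).δ 0 (pathSimplex γ) =
      (TopCat.toSSet.obj (TopCat.of S)).δ 1 (pathSimplex γ) := by
    apply (TopCat.toSSetObjEquiv (TopCat.of S) _).injective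
    ext z
    obtain rfl : z = stdSimplex.vertex 0 := Subsingleton.elim (α := stdSimplex ℝ (Fin 1)) _ _
    refine (TopCat.toSSetObjEquiv_δ_apply (n := 0) (pathSimplex γ) 0 _).trans
      (Eq.trans ?_ (TopCat.toSSetObjEquiv_δ_apply (n := 0) (pathSimplex γ) 1 _).symm)
    rw [stdSimplex.map_vertex, stdSimplex.map_vertex]
    exact γ.target.trans γ.source.symm
  refine (SSet.ιChainComplex_d _ _ (pathSimplex γ)).trans ?_
  simp [Fin.sum_univ_two, hf]
  rfl

/-- The homology class `[γ] ∈ H₁(S, ℝ)` of a loop `γ`: the class of the singular cycle `1 • γ`. -/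
def loopClass {x : S} (γ : Path x x) : H1 S :=
  ((singularChains S).liftCycles (pathChain γ) 0 (by simp) (pathChain_d γ) ≫
    (singularChains S).homologyπ 1) (ULift.up 1)

/-- A closed orientable surface has genus `g` if its first Betti number is `2 g`. -/
def HasGenus (S : Type u) [TopologicalSpace S] (g : ℕ) : Prop :=
  Module.finrank ℝ (H1 S) = 2 * g

end Homology

/-! ### Length of arcs and the stable norm -/

section Metric

variable {S : Type u} [MetricSpace S]

/-- The length of an arc; the arc is rectifiable when this is finite. -/
def pathLength {x y : S} (γ : Path x y) : ℝ≥0∞ := eVariationOn γ univ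

/-- The stable norm on `H₁(S, ℝ)`: the infimum of the masses `∑ |rᵢ| length(γᵢ)` over the real
`1`-cycles `∑ rᵢ γᵢ` made of loops that represent the given class. A nonrectifiable loop has
infinite length, so effectively only rectifiable loops count. -/
def stableNorm (h : H1 S) : ℝ≥0∞ :=
  ⨅ (m : ℕ) (r : Fin m → ℝ) (p : Fin m → S) (γ : ∀ i, Path (p i) (p i))
    (_ : ∑ i, r i • loopClass (γ i) = h), ∑ i, ENNReal.ofReal |r i| * pathLength (γ i)

/-- The `r`-neighbourhood `B_r(E)` of a set of homology classes, for the stable norm. -/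
def homologyBall (r : ℝ) (E : Set (H1 S)) : Set (H1 S) :=
  {w | ∃ v ∈ E, stableNorm (v - w) < ENNReal.ofReal r}

end Metric

/-! ### Isotopies, homological displacement and rotation sets -/

/-- An isotopy from the identity to `f`: a continuous family `(f_t)` of homeomorphisms. -/
structure Isotopy {S : Type u} [TopologicalSpace S] (f : S ≃ₜ S) where
  toFun : I → S ≃ₜ S
  continuous_toFun : Continuous fun p : I × S => toFun p.1 p.2
  map_zero : toFun 0 = Homeomorph.refl S
  map_one : toFun 1 = f

/-- The arc `t ↦ f_t(x)` from `x` to `f(x)`. -/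
def Isotopy.arc {S : Type u} [TopologicalSpace S] {f : S ≃ₜ S} (J : Isotopy f) (x : S) :
    Path x (f x) where
  toFun t := J.toFun t x
  continuous_toFun := J.continuous_toFun.comp (Continuous.prodMk_left x)
  source' := by simp [J.map_zero]
  target' := by simp [J.map_one]

/-- The homological displacement function `Φ_f(x) = [γ_x * J_x * γ_{f(x)}⁻¹]`, for a family of
arcs `γ_x` from a base point `b` to `x` and an isotopy `J` from the identity to `f`. -/
def displacement {S : Type u} [TopologicalSpace S] {f : S ≃ₜ S} (J : Isotopy f) {b : S}
    (γ : ∀ x, Path b x) (x : S) : H1 S :=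
  loopClass ((γ x).trans ((J.arc x).trans (γ (f x)).symm))

/-- The Birkhoff sum `Φⁿ_f(x) = ∑_{k<n} Φ_f(f^k(x))`. -/
def displacementSum {S : Type u} [TopologicalSpace S] {f : S ≃ₜ S} (J : Isotopy f) {b : S}
    (γ : ∀ x, Path b x) (n : ℕ) (x : S) : H1 S :=
  birkhoffSum f (displacement J γ) n x

/-- The Misiurewicz–Ziemian rotation set of `f` over `E`: all limits of
`Φ^{n_k}_f(x_k) / n_k` with `x_k ∈ E` and `n_k → ∞`. -/
def rotationSet {S : Type u} [MetricSpace S] {f : S ≃ₜ S} (J : Isotopy f) {b : S}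
    (γ : ∀ x, Path b x) (E : Set S) : Set (H1 S) :=
  {v | ∃ (n : ℕ → ℕ) (x : ℕ → S), (∀ k, x k ∈ E) ∧ Tendsto n atTop atTop ∧
    Tendsto (fun k => stableNorm ((n k : ℝ)⁻¹ • displacementSum J γ (n k) (x k) - v))
      atTop (𝓝 0)}

/-! ### Essential sets and dynamically fully essential points -/

section Essential

variable {S : Type u} [TopologicalSpace S]

/-- A set is inessential if it has an open neighbourhood all of whose loops are homotopically
trivial in `S`. -/
def IsInessential (E : Set S) : Prop :=
  ∃ W : Set S, IsOpen W ∧ E ⊆ W ∧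
    ∀ (x : S) (γ : Path x x), range γ ⊆ W → γ.Homotopic (Path.refl x)

/-- A set is fully essential if its complement is inessential. -/
def IsFullyEssential (E : Set S) : Prop := IsInessential Eᶜ

/-- The orbit `⋃_{n ∈ ℤ} fⁿ(V)` of a set. -/
def orbitSet (f : S ≃ₜ S) (V : Set S) : Set S := ⋃ n : ℤ, (f ^ n) '' V

/-- The set `C(f)` of dynamically fully essential points. -/
def fullyEssentialPoints (f : S ≃ₜ S) : Set S :=
  {x | ∀ V ∈ 𝓝 x, IsFullyEssential (orbitSet f V)}

end Essential

end SurfaceRotation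

end

/-! For an arc `α` from `x` to `y`, close every arc up with the family `γ`. The isotopy sweeps `α`
across a square, and summing along the orbit gives `Φⁿ(x) - Φⁿ(y) = [α] - [fⁿ ∘ α]`
(`displacementSum_sub`). So it suffices to find, for each `x` and `n`, an arc `α` from `x` to a
point of a fixed finite union of iterates of `U` with both classes bounded uniformly.

By compactness finitely many iterates of `interior U` cover everything outside an open set `W`
without essential loops; let `K ⊆ W` be the compact complement of their union. If `x ∈ K`, take a
homologically nontrivial loop of bounded length at `fⁿ(x)` and pull it back by `f⁻ⁿ`. As `f` acts
trivially on homology, the pulled-back loop is still nontrivial, so it leaves `W`; let `α` be its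
piece up to a point outside `K`, stopped before leaving `W`. Then `[fⁿ ∘ α]` is bounded because `fⁿ
∘ α` is short, and `[α]` is bounded because in `W` the class depends only on the endpoints, which
stay in a compact set (`exists_stableNorm_arcClass_le_of_inessential`).

The endpoint is `fᵏ(y)` with `y ∈ U` and `k` in a finite set; replacing it by `y` costs a bounded
amount since `Φ` is bounded. -/

noncomputable section

namespace SurfaceRotation

/-! ### Classes of arcs modulo boundaries -/

section Homology

open CategoryTheory AlgebraicTopology

variable {S : Type u} [TopologicalSpace S] {x y z w : S}

/-- The class of the chain carried by a path, modulo boundaries. -/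
def opClass (α : Path x y) : (singularChains S).opcycles 1 :=
  (pathChain α ≫ (singularChains S).pOpcycles 1) (ULift.up 1)

theorem opClass_congr {α : Path x y} {β : Path z w} (h : ∀ t, α t = β t) :
    opClass α = opClass β := by
  obtain rfl : x = z := by simpa using h 0
  obtain rfl : y = w := by simpa using h 1
  obtain rfl : α = β := Path.ext (funext h)
  rfl

/-- The embedding of homology into chains modulo boundaries. -/
def toOpcycles (S : Type u) [TopologicalSpace S] :
    H1 S →ₗ[ℝ] (singularChains S).opcycles 1 :=
  ((singularChains S).homologyι 1).hom

/-- Identities in `H1 S` may therefore be checked modulo boundaries, where open arcs have classes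
too. -/
theorem toOpcycles_injective : Function.Injective (toOpcycles S) :=
  (ModuleCat.mono_iff_injective ((singularChains S).homologyι 1)).1 inferInstance

theorem toOpcycles_loopClass (α : Path x x) : toOpcycles S (loopClass α) = opClass α := by
  change (singularChains S).homologyι 1 (loopClass α) = opClass α
  rw [loopClass, opClass, ← ModuleCat.comp_apply]
  simp

/-- The boundary relation given by a singular triangle. -/
theorem opClass_triangle {a b c : S} (T : C(stdSimplex ℝ (Fin 3), S))
    (α : Path b c) (β : Path a c) (δ : Path a b)
    (hα : ∀ p : stdSimplex ℝ (Fin 2),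
      T (stdSimplex.map (Fin.succAbove 0) p) = α (stdSimplexHomeomorphUnitInterval p))
    (hβ : ∀ p : stdSimplex ℝ (Fin 2),
      T (stdSimplex.map (Fin.succAbove 1) p) = β (stdSimplexHomeomorphUnitInterval p))
    (hδ : ∀ p : stdSimplex ℝ (Fin 2),
      T (stdSimplex.map (Fin.succAbove 2) p) = δ (stdSimplexHomeomorphUnitInterval p)) :
    opClass β = opClass α + opClass δ := by
  let X := TopCat.toSSet.obj (TopCat.of S)
  let τ : X.obj (Opposite.op (SimplexCategory.mk 2)) :=
    (TopCat.toSSetObjEquiv (TopCat.of S) _).symm T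
  have hface : ∀ {p q : S} (ε : Path p q) (i : Fin 3),
      (∀ p : stdSimplex ℝ (Fin 2),
        T (stdSimplex.map (Fin.succAbove i) p) = ε (stdSimplexHomeomorphUnitInterval p)) →
      X.δ i τ = pathSimplex ε := by
    intro p q ε i hε
    apply (TopCat.toSSetObjEquiv (TopCat.of S) _).injective
    ext p
    refine (TopCat.toSSetObjEquiv_δ_apply (n := 1) τ i p).trans ?_
    exact hε p
  let c₂ : ModuleCat.of ℝ (ULift.{u} ℝ) ⟶ (singularChains S).X 2 := X.ιChainComplex τ
  have hd : c₂ ≫ (singularChains S).d 2 1 = pathChain α - pathChain β + pathChain δ := by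
    refine (SSet.ιChainComplex_d X _ τ).trans ?_
    rw [Fin.sum_univ_three, hface α 0 hα, hface β 1 hβ, hface δ 2 hδ]
    simp only [Fin.val_zero, pow_zero, one_smul, Fin.val_one, pow_one, Fin.val_two, even_two,
      Even.neg_pow, one_pow, neg_smul]
    rw [sub_eq_add_neg]
    rfl
  have hz : (c₂ ≫ (singularChains S).d 2 1) ≫ (singularChains S).pOpcycles 1 = 0 := by
    rw [Category.assoc, (singularChains S).d_pOpcycles, Limits.comp_zero]
  rw [hd, Preadditive.add_comp, Preadditive.sub_comp] at hz
  have e : opClass α - opClass β + opClass δ = 0 :=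
    congrArg (fun φ => φ.hom (ULift.up (1 : ℝ))) hz
  rw [← sub_eq_zero, ← neg_eq_zero, ← e]
  abel

theorem stdSimplex_map_apply {m n : ℕ} (f : Fin m → Fin n) (p : stdSimplex ℝ (Fin m)) (j : Fin n) :
    stdSimplex.map f p j = ∑ i, if f i = j then p i else 0 := by
  rw [stdSimplex.map_coe, FunOnFinite.linearMap_apply_apply, Finset.sum_filter]

theorem opClass_refl (x : S) : opClass (Path.refl x) = 0 := by
  have h := opClass_triangle (ContinuousMap.const _ x) (Path.refl x) (Path.refl x) (Path.refl x)
    (fun _ => rfl) (fun _ => rfl) (fun _ => rfl)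
  simpa using h

/-- The boundary relation given by a singular square. -/
theorem opClass_square {a b c d : S} (H : C(I × I, S))
    (left : Path a b) (top : Path b d) (bottom : Path a c) (right : Path c d)
    (hl : ∀ t, H (0, t) = left t) (ht : ∀ s, H (s, 1) = top s)
    (hb : ∀ s, H (s, 0) = bottom s) (hr : ∀ t, H (1, t) = right t) :
    opClass left + opClass top = opClass bottom + opClass right := by
  let diag : Path a d := ⟨⟨fun t => H (t, t), by fun_prop⟩, by simp [hl], by simp [hr]⟩
  -- The square is cut along its diagonal: since `u ≤ v`, the maps `(u, v)` and `(v, u)` parametrize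
  -- the two triangles.
  let u : C(stdSimplex ℝ (Fin 3), I) :=
    ⟨fun p => ⟨p 2, stdSimplex.zero_le p 2, stdSimplex.le_one p 2⟩,
      ((continuous_apply 2).comp continuous_subtype_val).subtype_mk _⟩
  let v : C(stdSimplex ℝ (Fin 3), I) :=
    ⟨fun p => σ ⟨p 0, stdSimplex.zero_le p 0, stdSimplex.le_one p 0⟩,
      continuous_symm.comp (((continuous_apply 0).comp continuous_subtype_val).subtype_mk _)⟩
  have hu : ∀ (i : Fin 3) (p : stdSimplex ℝ (Fin 2)),
      u (stdSimplex.map (Fin.succAbove i) p) =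
        if i = 2 then 0 else stdSimplexHomeomorphUnitInterval p := by
    intro i p
    apply Subtype.ext
    change stdSimplex.map (Fin.succAbove i) p 2 = _
    rw [stdSimplex_map_apply, Fin.sum_univ_two]
    fin_cases i
    · exact (congrArg₂ _ (if_neg (by decide)) (if_pos (by decide))).trans (zero_add _)
    · exact (congrArg₂ _ (if_neg (by decide)) (if_pos (by decide))).trans (zero_add _)
    · exact (congrArg₂ _ (if_neg (by decide)) (if_neg (by decide))).trans (zero_add _)
  have hv : ∀ (i : Fin 3) (p : stdSimplex ℝ (Fin 2)),
      v (stdSimplex.map (Fin.succAbove i) p) =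
        if i = 0 then 1 else stdSimplexHomeomorphUnitInterval p := by
    intro i p
    have h1 : 1 - p 0 = p 1 := sub_eq_of_eq_add' (stdSimplex.add_eq_one p).symm
    apply Subtype.ext
    change 1 - stdSimplex.map (Fin.succAbove i) p 0 = _
    rw [stdSimplex_map_apply, Fin.sum_univ_two]
    fin_cases i
    · exact (congrArg (1 - ·) ((congrArg₂ _ (if_neg (by decide)) (if_neg (by decide))).trans
        (zero_add _))).trans (sub_zero _)
    · exact (congrArg (1 - ·) ((congrArg₂ _ (if_pos (by decide)) (if_neg (by decide))).trans
        (add_zero _))).trans h1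
    · exact (congrArg (1 - ·) ((congrArg₂ _ (if_pos (by decide)) (if_neg (by decide))).trans
        (add_zero _))).trans h1
  have lower := opClass_triangle (H.comp (u.prodMk v)) top diag left
    (fun p => by change H (u _, v _) = _; rw [hu, hv]; simp [ht]) (fun p => by simp [hu, hv, diag])
    (fun p => by simp [hu, hv, hl])
  have upper := opClass_triangle (H.comp (v.prodMk u)) right diag bottom
    (fun p => by change H (v _, u _) = _; rw [hu, hv]; simp [hr]) (fun p => by simp [hu, hv, diag])
    (fun p => by simp [hu, hv, hb])
  rw [add_comm, ← lower, upper, add_comm]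

end Homology

/-! ### Calculus of arc classes and the action of the isotopy -/

section PathClasses

variable {S : Type u} [TopologicalSpace S] {x y z w : S}

theorem opClass_eq_of_homotopic {α β : Path x y} (h : α.Homotopic β) : opClass α = opClass β := by
  obtain ⟨F⟩ := h
  simpa [opClass_refl] using opClass_square F.toContinuousMap α (Path.refl y) (Path.refl x) β
    (by simp) (by simp) (by simp) (by simp)

/-- The parameters come in any order, so this one relation yields the rules for both reversal and
concatenation. -/
theorem opClass_subpath_add (α : Path x y) (r s t : I) :
    opClass (α.subpath r s) + opClass (α.subpath s t) = opClass (α.subpath r t) := by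
  let H : C(I × I, S) :=
    ⟨fun p => α (Set.Icc.convexComb r (Set.Icc.convexComb s t p.1) p.2), by
      have h := (Set.Icc.continuous_convexComb s t).comp (continuous_fst (X := I) (Y := I))
      exact α.continuous.comp (Set.Icc.continuous_convexComb_prod.comp
        ((continuous_const (y := r)).prodMk (h.prodMk continuous_snd)))⟩
  simpa [opClass_refl] using opClass_square H (α.subpath r s) (α.subpath s t) (Path.refl (α r))
    (α.subpath r t) (by simp [H, Path.subpath]) (by simp [H, Path.subpath]) (by simp [H])
    (by simp [H, Path.subpath])

theorem opClass_subpath_zero_one (α : Path x y) : opClass (α.subpath 0 1) = opClass α :=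
  opClass_congr fun t => by simp [Path.subpath]

theorem opClass_symm (α : Path x y) : opClass α.symm = -opClass α := by
  have h := opClass_subpath_add α 0 1 0
  rw [opClass_subpath_zero_one, Path.subpath_self, opClass_refl,
    opClass_congr (α := α.subpath 1 0) (β := α.symm) fun t => by
      change α (Set.Icc.convexComb 1 0 t) = α (σ t)
      rw [← Set.Icc.convexComb_symm, Set.Icc.convexComb_zero_one]] at h
  exact (neg_eq_of_add_eq_zero_right h).symm

theorem opClass_trans (α : Path x y) (β : Path y z) :
    opClass (α.trans β) = opClass α + opClass β := by
  have h := opClass_subpath_add (α.trans β) 0 ⟨1 / 2, by norm_num, by norm_num⟩ 1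
  rw [opClass_subpath_zero_one] at h
  rw [← h]
  congr 1
  · refine opClass_congr fun t => ?_
    have ht : (t : ℝ) * 2⁻¹ ≤ 2⁻¹ := by linarith [t.2.2]
    simp only [Path.subpath, Path.trans_apply, Path.coe_mk', ContinuousMap.coe_mk,
      Function.comp_apply]
    rw [dif_pos (by simpa using ht)]
    congr 1
    ext
    simp
    ring
  · refine opClass_congr fun t => ?_
    simp only [Path.subpath, Path.trans_apply, Path.coe_mk', ContinuousMap.coe_mk,
      Function.comp_apply]
    split_ifs with ht
    · have ht' : t = 0 := by
        simp at ht
        exact Subtype.ext (le_antisymm (by push_cast; linarith) t.2.1)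
      subst ht'
      simp
    · congr 1
      ext
      simp
      ring

/-- The boundary of the square `(t, s) ↦ f_t(α(s))`. -/
theorem opClass_isotopy {f : S ≃ₜ S} (J : Isotopy f) (α : Path x y) :
    opClass α + opClass (J.arc y) = opClass (J.arc x) + opClass (α.map f.continuous) := by
  let H : C(I × I, S) :=
    ⟨fun p => J.toFun p.1 (α p.2), J.continuous_toFun.comp
      (continuous_fst.prodMk (α.continuous.comp continuous_snd))⟩
  exact opClass_square H _ _ _ _ (fun t => by simp [H, J.map_zero])
    (fun t => by simp [H, Isotopy.arc]) (fun t => by simp [H, Isotopy.arc])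
    (fun t => by simp [H, J.map_one])

/-- The class of the loop obtained by closing up an arc with a family of arcs from `b`. -/
def arcClass {b : S} (γ : ∀ x, Path b x) (α : Path x y) : H1 S :=
  loopClass ((γ x).trans (α.trans (γ y).symm))

variable {b : S} {γ : ∀ x, Path b x}

theorem toOpcycles_arcClass (α : Path x y) :
    toOpcycles S (arcClass γ α) = opClass (γ x) + opClass α - opClass (γ y) := by
  rw [arcClass, toOpcycles_loopClass, opClass_trans, opClass_trans, opClass_symm]
  abel

theorem arcClass_congr {α : Path x y} {β : Path z w} (h : ∀ t, α t = β t) :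
    arcClass γ α = arcClass γ β := by
  obtain rfl : x = z := by simpa using h 0
  obtain rfl : y = w := by simpa using h 1
  obtain rfl : α = β := Path.ext (funext h)
  rfl

theorem arcClass_eq_of_opClass_eq {α β : Path x y} (h : opClass α = opClass β) :
    arcClass γ α = arcClass γ β :=
  toOpcycles_injective (by rw [toOpcycles_arcClass, toOpcycles_arcClass, h])

theorem arcClass_loop (α : Path x x) : arcClass γ α = loopClass α :=
  toOpcycles_injective (by rw [toOpcycles_arcClass, toOpcycles_loopClass]; abel)

theorem loopClass_eq_zero_iff {α : Path x x} : loopClass α = 0 ↔ opClass α = 0 := by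
  rw [← toOpcycles_loopClass]
  refine ⟨fun h => by rw [h, map_zero], fun h => toOpcycles_injective (by rw [h, map_zero])⟩

theorem arcClass_trans (α : Path x y) (β : Path y z) :
    arcClass γ (α.trans β) = arcClass γ α + arcClass γ β :=
  toOpcycles_injective (by
    rw [map_add, toOpcycles_arcClass, toOpcycles_arcClass, toOpcycles_arcClass, opClass_trans]; abel)

theorem arcClass_subpath_add (α : Path x y) (r s t : I) :
    arcClass γ (α.subpath r s) + arcClass γ (α.subpath s t) = arcClass γ (α.subpath r t) :=
  toOpcycles_injective (by
    rw [map_add, toOpcycles_arcClass, toOpcycles_arcClass, toOpcycles_arcClass,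
      ← opClass_subpath_add α r s t]; abel)

theorem displacement_sub {f : S ≃ₜ S} (J : Isotopy f) (α : Path x y) :
    displacement J γ x - displacement J γ y =
      arcClass γ α - arcClass γ (α.map f.continuous) := by
  change arcClass γ (J.arc x) - arcClass γ (J.arc y) = _
  apply toOpcycles_injective
  have h := opClass_isotopy J α
  rw [map_sub, map_sub]
  simp only [toOpcycles_arcClass]
  rw [← sub_eq_zero] at h ⊢
  rw [← neg_eq_zero, ← h]
  abel

/-- The one-step identity `displacement_sub`, applied to `α`, `f ∘ α`, `f² ∘ α`, …, telescopes. -/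
theorem displacementSum_sub {f : S ≃ₜ S} (J : Isotopy f) (n : ℕ) (α : Path x y) :
    displacementSum J γ n x - displacementSum J γ n y =
      arcClass γ α - arcClass γ (α.map (f.continuous.iterate n)) := by
  induction n generalizing x y with
  | zero =>
    rw [arcClass_congr (α := α.map (f.continuous.iterate 0)) (β := α) fun _ => rfl]
    simp [displacementSum]
  | succ n ih =>
    have h := ih (α.map f.continuous)
    have h' := displacement_sub (γ := γ) J α
    unfold displacementSum at h ⊢
    rw [birkhoffSum_succ', birkhoffSum_succ', add_sub_add_comm, h, h', sub_add_sub_cancel]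
    rfl

/-- For a loop, the two arcs swept by the endpoints in `opClass_isotopy` coincide and cancel. -/
theorem opClass_map_iterate {f : S ≃ₜ S} (J : Isotopy f) (n : ℕ) (α : Path x x) :
    opClass (α.map (f.continuous.iterate n)) = opClass α := by
  induction n generalizing x with
  | zero => exact opClass_congr fun _ => rfl
  | succ n ih =>
    refine (ih (α.map f.continuous)).trans ?_
    have h := opClass_isotopy J α
    rw [add_comm] at h
    exact (add_left_cancel h).symm

end PathClasses

/-! ### Length and the stable seminorm -/

section StableNorm

variable {S : Type u} [MetricSpace S] {x y z : S}

theorem pathLength_symm (α : Path x y) : pathLength α.symm = pathLength α := by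
  have key : ∀ {x y : S} (α : Path x y), pathLength α.symm ≤ pathLength α := fun α =>
    eVariationOn.comp_le_of_antitoneOn (α : I → S) σ
      (strictAnti_symm.antitone.antitoneOn _) (mapsTo_univ _ _)
  exact (key α).antisymm (by simpa using key α.symm)

theorem pathLength_subpath_zero_le (α : Path x y) (t : I) :
    pathLength (α.subpath 0 t) ≤ pathLength α := by
  refine eVariationOn.comp_le_of_monotoneOn (α : I → S) (Set.Icc.convexComb 0 t)
    (Monotone.monotoneOn (fun r s h => ?_) _) (mapsTo_univ _ _)
  have h' : (r : ℝ) ≤ s := h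
  rw [← Subtype.coe_le_coe]
  simp only [Set.Icc.coe_convexComb]
  have := mul_le_mul_of_nonneg_right h' t.2.1
  simpa using this

theorem pathLength_trans_le (α : Path x y) (β : Path y z) :
    pathLength (α.trans β) ≤ pathLength α + pathLength β := by
  let h : I := ⟨1 / 2, by norm_num, by norm_num⟩
  rw [pathLength, ← Iic_union_Ici (a := h), eVariationOn.union _ isGreatest_Iic isLeast_Ici]
  gcongr
  · rw [eVariationOn.congr (g := α ∘ fun t : I => projIcc (0 : ℝ) 1 zero_le_one (2 * t))]
    · refine eVariationOn.comp_le_of_monotoneOn _ _ ?_ (mapsTo_univ _ _)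
      exact ((monotone_projIcc _).comp fun r s hrs => by
        have : (r : ℝ) ≤ s := hrs
        simpa using this).monotoneOn _
    · intro t ht
      have ht' : (t : ℝ) ≤ 1 / 2 := ht
      change (if (t : ℝ) ≤ 1 / 2 then α.extend (2 * t) else β.extend (2 * t - 1)) = _
      rw [if_pos ht']
      rfl
  · rw [eVariationOn.congr (g := β ∘ fun t : I => projIcc (0 : ℝ) 1 zero_le_one (2 * t - 1))]
    · refine eVariationOn.comp_le_of_monotoneOn _ _ ?_ (mapsTo_univ _ _)
      exact ((monotone_projIcc _).comp fun r s hrs => by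
        have : (r : ℝ) ≤ s := hrs
        simpa using this).monotoneOn _
    · intro t ht
      have ht' : 1 / 2 ≤ (t : ℝ) := ht
      change (if (t : ℝ) ≤ 1 / 2 then α.extend (2 * t) else β.extend (2 * t - 1)) = _
      split_ifs with h2
      · rw [show t = h from Subtype.ext (h2.antisymm ht')]
        simp [h]
      · rfl

theorem stableNorm_sum_le {ι : Type*} [Fintype ι] (r : ι → ℝ) (p : ι → S)
    (α : ∀ i, Path (p i) (p i)) :
    stableNorm (∑ i, r i • loopClass (α i)) ≤ ∑ i, ENNReal.ofReal |r i| * pathLength (α i) := by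
  let e := (Fintype.equivFin ι).symm
  unfold stableNorm
  refine iInf_le_of_le (Fintype.card ι) <| iInf_le_of_le (fun i => r (e i)) <|
    iInf_le_of_le (fun i => p (e i)) <| iInf_le_of_le (fun i => α (e i)) <| iInf_le_of_le ?_ ?_
  · exact e.sum_comp fun i => r i • loopClass (α i)
  · exact (e.sum_comp fun i => ENNReal.ofReal |r i| * pathLength (α i)).le

theorem stableNorm_loopClass_le (α : Path x x) : stableNorm (loopClass α) ≤ pathLength α := by
  simpa using stableNorm_sum_le (fun _ : Unit => 1) (fun _ => x) (fun _ => α)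

theorem stableNorm_zero : stableNorm (0 : H1 S) = 0 := by
  simpa using stableNorm_sum_le (S := S) (ι := Empty) Empty.elim Empty.elim (fun i => i.elim)

theorem exists_sum_lt_of_stableNorm_lt {h : H1 S} {a : ℝ≥0∞} (ha : stableNorm h < a) :
    ∃ (m : ℕ) (r : Fin m → ℝ) (p : Fin m → S) (α : ∀ i, Path (p i) (p i)),
      ∑ i, r i • loopClass (α i) = h ∧ ∑ i, ENNReal.ofReal |r i| * pathLength (α i) < a := by
  simpa only [stableNorm, iInf_lt_iff, exists_prop] using ha

theorem stableNorm_add_le (h k : H1 S) : stableNorm (h + k) ≤ stableNorm h + stableNorm k := by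
  refine le_of_forall_gt fun a ha => ?_
  obtain ⟨u, hu, v, hv, huv⟩ := ENNReal.exists_add_lt_of_add_lt ha
  obtain ⟨m, r, p, α, rfl, hα⟩ := exists_sum_lt_of_stableNorm_lt hu
  obtain ⟨n, s, q, β, rfl, hβ⟩ := exists_sum_lt_of_stableNorm_lt hv
  have key := stableNorm_sum_le (Sum.elim r s) (Sum.elim p q)
    (fun i => match i with
      | Sum.inl i => α i
      | Sum.inr i => β i)
  simp only [Fintype.sum_sum_type, Sum.elim_inl, Sum.elim_inr] at key
  exact key.trans_lt ((ENNReal.add_lt_add hα hβ).trans huv)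

theorem stableNorm_smul_le (a : ℝ) (h : H1 S) :
    stableNorm (a • h) ≤ ENNReal.ofReal |a| * stableNorm h := by
  rcases eq_or_ne a 0 with rfl | ha
  · simp [stableNorm_zero]
  have h0 : ENNReal.ofReal |a| ≠ 0 := by simpa using ha
  rw [← ENNReal.div_le_iff' h0 ENNReal.ofReal_ne_top]
  refine le_of_forall_gt fun c hc => ?_
  obtain ⟨m, r, p, α, rfl, hα⟩ := exists_sum_lt_of_stableNorm_lt hc
  refine lt_of_le_of_lt ?_ hα
  rw [ENNReal.div_le_iff' h0 ENNReal.ofReal_ne_top]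
  have key := stableNorm_sum_le (fun i => a * r i) p α
  simpa only [mul_smul, ← Finset.smul_sum, abs_mul, ENNReal.ofReal_mul (abs_nonneg a), mul_assoc,
    ← Finset.mul_sum] using key

theorem stableNorm_neg_le (h : H1 S) : stableNorm (-h) ≤ stableNorm h := by
  simpa using stableNorm_smul_le (-1) h

theorem stableNorm_sub_le (h k : H1 S) : stableNorm (h - k) ≤ stableNorm h + stableNorm k := by
  rw [sub_eq_add_neg]
  exact (stableNorm_add_le _ _).trans (add_le_add_right (stableNorm_neg_le k) _)

theorem stableNorm_arcClass_le {b : S} {γ : ∀ x, Path b x} {C : ℝ≥0}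
    (hγ : ∀ x, pathLength (γ x) ≤ C) (α : Path x y) :
    stableNorm (arcClass γ α) ≤ C + (pathLength α + C) := by
  refine (stableNorm_loopClass_le _).trans ((pathLength_trans_le _ _).trans ?_)
  refine add_le_add (hγ x) ((pathLength_trans_le _ _).trans (add_le_add_right ?_ _))
  rw [pathLength_symm]
  exact hγ y

end StableNorm

/-! ### Local triviality of homology -/

section LocalHomology

/-- Two arcs with the same endpoints inside a small enough set are homologous. -/
theorem exists_nhds_opClass_eq {S : Type u} [TopologicalSpace S]
    [ChartedSpace (EuclideanSpace ℝ (Fin 2)) S] (p : S) :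
    ∃ V ∈ 𝓝 p, ∀ (x y : S) (α β : Path x y), range α ⊆ V → range β ⊆ V →
      opClass α = opClass β := by
  let φ := chartAt (EuclideanSpace ℝ (Fin 2)) p
  obtain ⟨ε, hε, hball⟩ := Metric.isOpen_iff.1 φ.open_target (φ p)
    (φ.map_source (mem_chart_source _ p))
  refine ⟨φ.source ∩ φ ⁻¹' Metric.ball (φ p) ε, ?_, fun x y α β hα hβ => ?_⟩
  · exact inter_mem (φ.open_source.mem_nhds (mem_chart_source _ p))
      ((φ.continuousAt (mem_chart_source _ p)).preimage_mem_nhds (Metric.ball_mem_nhds _ hε))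
  have hcont : ∀ {δ : Path x y}, range δ ⊆ φ.source ∩ φ ⁻¹' Metric.ball (φ p) ε →
      Continuous fun t => φ (δ t) := fun h =>
    φ.continuousOn.comp_continuous (Path.continuous _) fun t => (h (mem_range_self t)).1
  have hmem : ∀ q : I × I,
      (1 - (q.1 : ℝ)) • φ (α q.2) + (q.1 : ℝ) • φ (β q.2) ∈ φ.target := fun q =>
    hball (convex_ball _ _ (hα (mem_range_self q.2)).2 (hβ (mem_range_self q.2)).2
      (sub_nonneg.2 q.1.2.2) q.1.2.1 (by ring))
  let H : C(I × I, S) :=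
    ⟨fun q => φ.symm ((1 - (q.1 : ℝ)) • φ (α q.2) + (q.1 : ℝ) • φ (β q.2)), by
      refine φ.symm.continuousOn.comp_continuous ?_ hmem
      have h1 := (hcont hα).comp (continuous_snd (X := I) (Y := I))
      have h2 := (hcont hβ).comp (continuous_snd (X := I) (Y := I))
      have h3 := continuous_subtype_val.comp (continuous_fst (X := I) (Y := I))
      exact ((continuous_const.sub h3).smul h1).add (h3.smul h2)⟩
  have hx : φ.symm (φ x) = x := φ.left_inv (by simpa using (hα (mem_range_self 0)).1)
  have hy : φ.symm (φ y) = y := φ.left_inv (by simpa using (hα (mem_range_self 1)).1)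
  simpa [opClass_refl] using opClass_square H α (Path.refl y) (Path.refl x) β
    (fun t => by simpa [H] using φ.left_inv (hα (mem_range_self t)).1)
    (fun t => by simp [H, ← add_smul, hy])
    (fun t => by simp [H, ← add_smul, hx])
    (fun t => by simpa [H] using φ.left_inv (hβ (mem_range_self t)).1)

end LocalHomology

/-! ### Bounds from the Riemannian metric -/

section Riemannian

variable {S : Type u} [MetricSpace S]
  [ChartedSpace (EuclideanSpace ℝ (Fin 2)) S]
  [RiemannianBundle (fun x : S => TangentSpace (𝓡 2) x)]
  [IsRiemannianManifold (𝓡 2) S]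

theorem exists_pathLength_lt {x y : S} {r : ℝ≥0∞} (h : edist x y < r) :
    ∃ α : Path x y, pathLength α < r := by
  have hd : ∀ x y : S, edist x y = Manifold.riemannianEDist (𝓡 2) x y := IsRiemannianManifold.out
  rw [hd] at h
  obtain ⟨γ, h0, h1, hγ, hlt⟩ := Manifold.exists_lt_of_riemannianEDist_lt h
  let α : Path x y := ⟨⟨fun t => γ t, hγ.continuousOn.comp_continuous continuous_subtype_val
    fun t => t.2⟩, by simpa using h0, by simpa using h1⟩
  refine ⟨α, lt_of_le_of_lt ?_ hlt⟩
  refine iSup_le ?_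
  rintro ⟨n, u, hu, -⟩
  -- The distance between consecutive points is at most the Riemannian length of the curve between
  -- them, so every variation sum is at most the total length.
  have hsum : ∑ i ∈ Finset.range n, edist (α (u (i + 1))) (α (u i)) ≤
      Manifold.pathELength (𝓡 2) γ (u 0) (u n) := by
    clear hlt
    induction n with
    | zero => simp
    | succ n ih =>
      rw [Finset.sum_range_succ, ← Manifold.pathELength_add (b := (u n : ℝ)) (hu (Nat.zero_le n))
        (hu n.le_succ)]
      refine add_le_add ih ?_
      rw [edist_comm, hd]
      exact Manifold.riemannianEDist_le_pathELength
        (hγ.mono (Icc_subset_Icc (u n).2.1 (u (n + 1)).2.2)) rfl rfl (hu n.le_succ)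
  exact hsum.trans (Manifold.pathELength_mono (u 0).2.1 (u n).2.2)

theorem exists_nhds_short_path {p : S} {O : Set S} (hO : O ∈ 𝓝 p) :
    ∃ V ∈ 𝓝 p, V ⊆ O ∧ ∀ x ∈ V, ∀ y ∈ V, ∃ α : Path x y, range α ⊆ O ∧ pathLength α ≤ 1 := by
  obtain ⟨ε, hε, hball⟩ := Metric.mem_nhds_iff.1 hO
  -- A path of length below `2δ` starting in the `δ`-ball stays in the `3δ`-ball.
  let δ := min (ε / 3) (1 / 3)
  have hδ : 0 < δ := by positivity
  have hδε : 3 * δ ≤ ε := by linarith [min_le_left (ε / 3) (1 / 3 : ℝ)]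
  have hδ1 : 3 * δ ≤ 1 := by linarith [min_le_right (ε / 3) (1 / 3 : ℝ)]
  refine ⟨Metric.ball p δ, Metric.ball_mem_nhds _ hδ,
    (Metric.ball_subset_ball (by linarith)).trans hball, fun x hx y hy => ?_⟩
  have hxy : edist x y < ENNReal.ofReal (2 * δ) := by
    rw [edist_dist]
    refine (ENNReal.ofReal_lt_ofReal_iff (by linarith)).2 ?_
    linarith [dist_triangle_right x y p, Metric.mem_ball.1 hx, Metric.mem_ball.1 hy]
  obtain ⟨α, hα⟩ := exists_pathLength_lt hxy
  refine ⟨α, ?_, hα.le.trans ?_⟩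
  · rintro _ ⟨t, rfl⟩
    apply hball
    have h1 : edist (α t) x < ENNReal.ofReal (2 * δ) := by
      refine lt_of_le_of_lt ?_ hα
      simpa [pathLength] using eVariationOn.edist_le (α : I → S) (mem_univ t) (mem_univ 0)
    rw [edist_dist, ENNReal.ofReal_lt_ofReal_iff (by linarith)] at h1
    rw [Metric.mem_ball]
    linarith [dist_triangle (α t) x p, Metric.mem_ball.1 hx]
  · rw [← ENNReal.ofReal_one]
    exact ENNReal.ofReal_le_ofReal (by linarith)

variable {b : S} {γ : ∀ x, Path b x} {C : ℝ≥0}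

/-- The arc need not be rectifiable: it is homologous to one of length at most `1`, and the closing
arcs add `C` twice. -/
theorem exists_nhds_stableNorm_arcClass_le (hγ : ∀ x, pathLength (γ x) ≤ C) (p : S) :
    ∃ V ∈ 𝓝 p, ∀ (x y : S) (α : Path x y), range α ⊆ V →
      stableNorm (arcClass γ α) ≤ C + (1 + C) := by
  obtain ⟨O, hO, hhom⟩ := exists_nhds_opClass_eq p
  obtain ⟨V, hV, hVO, hshort⟩ := exists_nhds_short_path hO
  refine ⟨V, hV, fun x y α hα => ?_⟩
  obtain ⟨β, hβ, hβ1⟩ := hshort x (hα ⟨0, by simp⟩) y (hα ⟨1, by simp⟩)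
  rw [arcClass_eq_of_opClass_eq (hhom x y α β (hα.trans hVO) hβ)]
  refine (stableNorm_arcClass_le hγ β).trans ?_
  gcongr

/-- Needed because the arcs of the isotopy may have infinite length. Finiteness of the class of `α`
restricted to `[0, t]` is locally constant in `t`, and `[0, 1]` is connected. -/
theorem stableNorm_arcClass_ne_top (hγ : ∀ x, pathLength (γ x) ≤ C) {x y : S} (α : Path x y) :
    stableNorm (arcClass γ α) ≠ ⊤ := by
  have hsub : ∀ s t, stableNorm (arcClass γ (α.subpath s t)) ≠ ⊤ →
      stableNorm (arcClass γ (α.subpath 0 s)) ≠ ⊤ →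
      stableNorm (arcClass γ (α.subpath 0 t)) ≠ ⊤ := by
    intro s t hst h0
    rw [← arcClass_subpath_add α 0 s t]
    exact ne_top_of_le_ne_top (ENNReal.add_ne_top.2 ⟨h0, hst⟩) (stableNorm_add_le _ _)
  have hloc : IsLocallyConstant fun t : I => stableNorm (arcClass γ (α.subpath 0 t)) ≠ ⊤ := by
    rw [IsLocallyConstant.iff_eventually_eq]
    intro t
    obtain ⟨V, hV, hVC⟩ := exists_nhds_stableNorm_arcClass_le hγ (α t)
    obtain ⟨ε, hε, hball⟩ := Metric.mem_nhds_iff.1 (α.continuous.continuousAt.preimage_mem_nhds hV)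
    filter_upwards [Metric.ball_mem_nhds t hε] with s hs
    have hfin : ∀ r ∈ Metric.ball t ε, ∀ q ∈ Metric.ball t ε,
        stableNorm (arcClass γ (α.subpath r q)) ≠ ⊤ := by
      intro r hr q hq
      refine ne_top_of_le_ne_top ?_ (hVC _ _ (α.subpath r q) ?_)
      · exact ENNReal.add_ne_top.2 ⟨ENNReal.coe_ne_top,
          ENNReal.add_ne_top.2 ⟨ENNReal.one_ne_top, ENNReal.coe_ne_top⟩⟩
      · rintro _ ⟨v, rfl⟩
        apply hball
        rw [Metric.mem_ball, Subtype.dist_eq, Set.Icc.coe_convexComb, ← Metric.mem_ball]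
        exact convex_ball (t : ℝ) ε hr hq (sub_nonneg.2 v.2.2) v.2.1 (by ring)
    have ht := Metric.mem_ball_self (x := t) hε
    exact propext ⟨hsub s t (hfin s hs t ht), hsub t s (hfin t ht s hs)⟩
  have h0 : stableNorm (arcClass γ (α.subpath 0 0)) ≠ ⊤ := by
    rw [Path.subpath_self, arcClass_loop, loopClass_eq_zero_iff.2 (opClass_refl _), stableNorm_zero]
    exact ENNReal.zero_ne_top
  have h1 := (hloc.apply_eq_of_preconnectedSpace 0 1).mp h0
  rwa [arcClass_congr (β := α) fun t => by simp [Path.subpath]] at h1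

theorem exists_stableNorm_displacement_le [CompactSpace S] (hγ : ∀ x, pathLength (γ x) ≤ C)
    {f : S ≃ₜ S} (J : Isotopy f) :
    ∃ M : ℝ≥0, ∀ x, stableNorm (displacement J γ x) ≤ M := by
  suffices h : ∃ M : ℝ≥0, ∀ x ∈ univ, stableNorm (displacement J γ x) ≤ M by simpa using h
  refine isCompact_univ.induction_on (p := fun s => ∃ M : ℝ≥0, ∀ x ∈ s,
    stableNorm (displacement J γ x) ≤ M) ⟨0, by simp⟩
    (fun s t hst ⟨M, hM⟩ => ⟨M, fun x hx => hM x (hst hx)⟩)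
    (fun s t ⟨M, hM⟩ ⟨N, hN⟩ => ⟨max M N, fun x hx => ?_⟩) (fun p _ => ?_)
  · rcases hx with hx | hx
    · exact (hM x hx).trans (by exact_mod_cast le_max_left M N)
    · exact (hN x hx).trans (by exact_mod_cast le_max_right M N)
  obtain ⟨V, hV, hVC⟩ := exists_nhds_stableNorm_arcClass_le hγ (f p)
  obtain ⟨O, hO, -, hshort⟩ :=
    exists_nhds_short_path (f.continuous.continuousAt.preimage_mem_nhds hV)
  have hp : stableNorm (displacement J γ p) ≠ ⊤ := stableNorm_arcClass_ne_top hγ (J.arc p)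
  lift stableNorm (displacement J γ p) to ℝ≥0 using hp with N hN
  refine ⟨O, mem_nhdsWithin_of_mem_nhds hO, N + ((C + (1 + C)) + (C + (1 + C))), fun y hy => ?_⟩
  obtain ⟨α, hα, hα1⟩ := hshort p (mem_of_mem_nhds hO) y hy
  have h := displacement_sub (γ := γ) J α
  rw [show displacement J γ y = displacement J γ p - (arcClass γ α -
    arcClass γ (α.map f.continuous)) by rw [← h]; abel]
  push_cast
  refine (stableNorm_sub_le _ _).trans (add_le_add hN.ge ((stableNorm_sub_le _ _).trans
    (add_le_add ((stableNorm_arcClass_le hγ α).trans (by gcongr)) (hVC _ _ _ ?_))))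
  rintro _ ⟨t, rfl⟩
  exact hα (mem_range_self t)

/-- Arcs in an open set without essential loops, with endpoints in a compact part of it, have
bounded classes. -/
theorem exists_stableNorm_arcClass_le_of_inessential (hγ : ∀ x, pathLength (γ x) ≤ C)
    {W K : Set S} (hW : IsOpen W) (hK : IsCompact K) (hKW : K ⊆ W)
    (hloop : ∀ (x : S) (α : Path x x), range α ⊆ W → opClass α = 0) :
    ∃ M : ℝ≥0, ∀ (x y : S) (α : Path x y), x ∈ K → y ∈ K → range α ⊆ W →
      stableNorm (arcClass γ α) ≤ M := by
  suffices h : ∃ M : ℝ≥0, ∀ (x y : S) (α : Path x y), (x, y) ∈ K ×ˢ K → range α ⊆ W →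
      stableNorm (arcClass γ α) ≤ M by
    obtain ⟨M, hM⟩ := h
    exact ⟨M, fun x y α hx hy => hM x y α ⟨hx, hy⟩⟩
  refine (hK.prod hK).induction_on (p := fun s => ∃ M : ℝ≥0, ∀ (x y : S) (α : Path x y),
    (x, y) ∈ s → range α ⊆ W → stableNorm (arcClass γ α) ≤ M) ⟨0, by simp⟩
    (fun s t hst ⟨M, hM⟩ => ⟨M, fun x y α hx => hM x y α (hst hx)⟩)
    (fun s t ⟨M, hM⟩ ⟨N, hN⟩ => ⟨max M N, fun x y α hx hα => ?_⟩) (fun q hq => ?_)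
  · rcases hx with hx | hx
    · exact (hM x y α hx hα).trans (by exact_mod_cast le_max_left M N)
    · exact (hN x y α hx hα).trans (by exact_mod_cast le_max_right M N)
  obtain ⟨V₁, hV₁, -, hs₁⟩ := exists_nhds_short_path (hW.mem_nhds (hKW hq.1))
  obtain ⟨V₂, hV₂, -, hs₂⟩ := exists_nhds_short_path (hW.mem_nhds (hKW hq.2))
  refine ⟨V₁ ×ˢ V₂, mem_nhdsWithin_of_mem_nhds (prod_mem_nhds hV₁ hV₂), ?_⟩
  -- One arc `α₀` in `W` from `V₁` to `V₂` serves as reference: any other is homologous to it up to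
  -- short connecting arcs. Without such an arc the bound is vacuous.
  by_cases hex : ∃ (x₀ y₀ : S) (α₀ : Path x₀ y₀), (x₀, y₀) ∈ V₁ ×ˢ V₂ ∧ range α₀ ⊆ W
  swap
  · exact ⟨0, fun x y α hx hα => (hex ⟨x, y, α, hx, hα⟩).elim⟩
  obtain ⟨x₀, y₀, α₀, h₀, hα₀⟩ := hex
  have hfin := stableNorm_arcClass_ne_top hγ α₀
  lift stableNorm (arcClass γ α₀) to ℝ≥0 using hfin with N hN
  refine ⟨(C + (1 + C)) + (N + (C + (1 + C))), fun x y α hxy hα => ?_⟩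
  obtain ⟨β₁, hβ₁, hl₁⟩ := hs₁ x hxy.1 x₀ h₀.1
  obtain ⟨β₂, hβ₂, hl₂⟩ := hs₂ y₀ h₀.2 y hxy.2
  have h := hloop x ((β₁.trans (α₀.trans β₂)).trans α.symm) (by
    simp only [Path.trans_range, Path.symm_range, union_subset_iff]
    exact ⟨⟨hβ₁, hα₀, hβ₂⟩, hα⟩)
  rw [opClass_trans, opClass_symm, ← sub_eq_add_neg, sub_eq_zero] at h
  rw [← arcClass_eq_of_opClass_eq h, arcClass_trans, arcClass_trans]
  push_cast
  refine (stableNorm_add_le _ _).trans (add_le_add ?_ ((stableNorm_add_le _ _).trans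
    (add_le_add hN.ge ?_)))
  · exact (stableNorm_arcClass_le hγ β₁).trans (by gcongr)
  · exact (stableNorm_arcClass_le hγ β₂).trans (by gcongr)

end Riemannian

/-! ### Shadowing of orbits and rotation sets -/

section RotationSets

variable {S : Type u} [MetricSpace S]

theorem exists_loopClass_ne_zero {h : H1 S} (h0 : h ≠ 0) (hfin : stableNorm h ≠ ⊤) :
    ∃ (a : S) (τ : Path a a), pathLength τ ≠ ⊤ ∧ loopClass τ ≠ 0 := by
  by_contra! hall
  obtain ⟨m, r, p, α, rfl, hα⟩ := exists_sum_lt_of_stableNorm_lt (lt_top_iff_ne_top.2 hfin)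
  refine h0 (Finset.sum_eq_zero fun i _ => ?_)
  rcases eq_or_ne (r i) 0 with hr | hr
  · rw [hr, zero_smul]
  · rw [hall (p i) (α i) ?_, smul_zero]
    intro htop
    refine (ENNReal.sum_lt_top.1 hα i (Finset.mem_univ i)).ne ?_
    rw [htop, ENNReal.mul_top (by simpa using hr)]

theorem rotationSet_eq_univ {f : S ≃ₜ S} {J : Isotopy f} {b : S} {γ : ∀ x, Path b x} {U : Set S}
    {M : ℝ≥0} (hM : ∀ (n : ℕ) (x : S), ∃ y ∈ U,
      stableNorm (displacementSum J γ n x - displacementSum J γ n y) ≤ M) :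
    rotationSet J γ U = rotationSet J γ univ := by
  refine Subset.antisymm (fun v ⟨n, x, _, hn, hv⟩ => ⟨n, x, fun _ => mem_univ _, hn, hv⟩) ?_
  rintro v ⟨n, x, -, hn, hv⟩
  choose y hyU hy using fun k => hM (n k) (x k)
  refine ⟨n, y, hyU, hn, ?_⟩
  have hlim : Tendsto (fun k => ENNReal.ofReal |(n k : ℝ)⁻¹| * M) atTop (𝓝 0) := by
    have h1 : Tendsto (fun k => |(n k : ℝ)⁻¹|) atTop (𝓝 0) := by
      simpa using ((tendsto_inv_atTop_zero (𝕜 := ℝ)).comp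
        (tendsto_natCast_atTop_atTop.comp hn)).abs
    simpa using ENNReal.Tendsto.mul_const (ENNReal.tendsto_ofReal h1)
      (Or.inr (ENNReal.coe_ne_top (r := M)))
  refine tendsto_of_tendsto_of_tendsto_of_le_of_le tendsto_const_nhds
    (by simpa only [add_zero] using hv.add hlim) (fun _ => zero_le) (fun k => ?_)
  have hsplit : (n k : ℝ)⁻¹ • displacementSum J γ (n k) (y k) - v =
      ((n k : ℝ)⁻¹ • displacementSum J γ (n k) (x k) - v) - (n k : ℝ)⁻¹ •
        (displacementSum J γ (n k) (x k) - displacementSum J γ (n k) (y k)) := by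
    rw [smul_sub]; abel
  rw [hsplit]
  refine (stableNorm_sub_le _ _).trans (add_le_add_right ((stableNorm_smul_le _ _).trans ?_) _)
  exact mul_le_mul_right (hy k) _

/-- One application of `f` changes the sum by `Φ(fⁿ(w)) - Φ(w)`, of stable norm at most `2M`. -/
theorem exists_stableNorm_displacementSum_zpow_sub_le {f : S ≃ₜ S} {J : Isotopy f} {b : S}
    {γ : ∀ x, Path b x} {M : ℝ≥0} (hM : ∀ x, stableNorm (displacement J γ x) ≤ M) (k : ℤ) :
    ∃ N : ℝ≥0, ∀ (n : ℕ) (y : S), stableNorm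
      (displacementSum J γ n ((f ^ k) y) - displacementSum J γ n y) ≤ N := by
  have hstep : ∀ (n : ℕ) (w : S), stableNorm
      (displacementSum J γ n (f w) - displacementSum J γ n w) ≤ (M + M : ℝ≥0) := by
    intro n w
    rw [displacementSum, displacementSum, birkhoffSum_apply_sub_birkhoffSum, ENNReal.coe_add]
    exact (stableNorm_sub_le _ _).trans (add_le_add (hM _) (hM _))
  induction k with
  | zero => exact ⟨0, fun n y => by simp [stableNorm_zero]⟩
  | succ k ih =>
    obtain ⟨N, hN⟩ := ih
    refine ⟨(M + M) + N, fun n y => ?_⟩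
    have e : (f ^ ((k : ℤ) + 1)) y = f ((f ^ (k : ℤ)) y) := by
      rw [add_comm, zpow_add, zpow_one]; rfl
    rw [e, ← sub_add_sub_cancel _ (displacementSum J γ n ((f ^ (k : ℤ)) y)), ENNReal.coe_add]
    exact (stableNorm_add_le _ _).trans (add_le_add (hstep n _) (hN n y))
  | pred k ih =>
    obtain ⟨N, hN⟩ := ih
    refine ⟨N + (M + M), fun n y => ?_⟩
    have e : (f ^ (-(k : ℤ))) y = f ((f ^ (-(k : ℤ) - 1)) y) := by
      have : (-(k : ℤ)) = 1 + (-(k : ℤ) - 1) := by ring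
      rw [this, zpow_add, zpow_one]
      simp
    have hs := hstep n ((f ^ (-(k : ℤ) - 1)) y)
    rw [← e] at hs
    rw [← sub_sub_sub_cancel_left _ _ (displacementSum J γ n ((f ^ (-(k : ℤ))) y)),
      ENNReal.coe_add]
    exact (stableNorm_sub_le _ _).trans (add_le_add (hN n y) hs)

variable [ChartedSpace (EuclideanSpace ℝ (Fin 2)) S]
  [RiemannianBundle (fun x : S => TangentSpace (𝓡 2) x)]
  [IsRiemannianManifold (𝓡 2) S] [CompactSpace S]

/-- Every orbit shadows, homologically and up to a uniform bound, the orbit of a point outside a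
given inessential set. -/
theorem exists_stableNorm_displacementSum_sub_le {f : S ≃ₜ S} (J : Isotopy f) {b : S}
    {γ : ∀ x, Path b x} {C : ℝ≥0} (hγ : ∀ x, pathLength (γ x) ≤ C) {a : S} {τ : Path a a}
    (hτfin : pathLength τ ≠ ⊤) (hτ : loopClass τ ≠ 0) {W K : Set S} (hW : IsOpen W)
    (hK : IsCompact K) (hKW : K ⊆ W)
    (hloop : ∀ (x : S) (α : Path x x), range α ⊆ W → opClass α = 0) :
    ∃ M : ℝ≥0, ∀ (n : ℕ) (x : S), ∃ y ∉ K,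
      stableNorm (displacementSum J γ n x - displacementSum J γ n y) ≤ M := by
  -- The margin between `K` and `K'` allows the arc to end outside `K` and still inside a compact
  -- subset of `W`.
  obtain ⟨K', hK', hKK', hK'W⟩ := exists_compact_between hK hW hKW
  obtain ⟨M, hM⟩ := exists_stableNorm_arcClass_le_of_inessential hγ hW hK' hK'W hloop
  lift pathLength τ to ℝ≥0 using hτfin with L hL
  refine ⟨M + (C + (((C + C) + (L + (C + C))) + C)), fun n x => ?_⟩
  by_cases hx : x ∈ K
  swap
  · exact ⟨x, hx, by simp [stableNorm_zero]⟩
  obtain ⟨x', rfl⟩ : ∃ x', x = f.symm^[n] x' := ⟨f^[n] x, (f.left_inv.iterate n x).symm⟩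
  -- `τ` is conjugated to a loop based at `x'`, the `n`-th image of the given point.
  let ζ : Path x' a := (γ x').symm.trans (γ a)
  have hζ : pathLength ζ ≤ C + C := (pathLength_trans_le _ _).trans
    (add_le_add ((pathLength_symm _).trans_le (hγ _)) (hγ _))
  let τ' : Path x' x' := ζ.trans (τ.trans ζ.symm)
  have hτ' : pathLength τ' ≤ (C + C) + (L + (C + C)) := (pathLength_trans_le _ _).trans
    (add_le_add hζ ((pathLength_trans_le _ _).trans
      (add_le_add hL.ge ((pathLength_symm _).trans_le hζ))))
  have hτ'0 : opClass τ' ≠ 0 := by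
    rw [opClass_trans ζ, opClass_trans τ, opClass_symm ζ, add_comm, add_assoc, neg_add_cancel,
      add_zero]
    rwa [Ne, ← loopClass_eq_zero_iff]
  let p : Path (f.symm^[n] x') (f.symm^[n] x') := τ'.map (f.symm.continuous.iterate n)
  have hfp : ∀ t, f^[n] (p t) = τ' t := fun t => f.right_inv.iterate n (τ' t)
  have hp0 : opClass p ≠ 0 := by
    rw [← opClass_map_iterate J n p, opClass_congr (β := τ') hfp]
    exact hτ'0
  have hclosed : IsClosed (p ⁻¹' (interior K')ᶜ) :=
    isOpen_interior.isClosed_compl.preimage p.continuous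
  have hexit : (p ⁻¹' (interior K')ᶜ).Nonempty := by
    by_contra hemp
    refine hp0 (hloop _ p ?_)
    rintro _ ⟨t, rfl⟩
    by_contra ht
    exact hemp ⟨t, fun h => ht (hK'W (interior_subset h))⟩
  -- The first time the loop is outside `interior K'`; up to then it lies in `K'`.
  obtain ⟨t₀, ht₀, hmin⟩ := hclosed.isCompact.exists_isLeast hexit
  have hbefore : ∀ t < t₀, p t ∈ interior K' := fun t ht => by
    by_contra h
    exact (hmin h).not_gt ht
  have ht₀pos : 0 < t₀ := by
    refine unitInterval.pos_iff_ne_zero.2 ?_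
    rintro rfl
    exact ht₀ (by simpa using hKK' hx)
  have hupto : ∀ t ≤ t₀, p t ∈ K' := by
    have hsub : Iio t₀ ⊆ p ⁻¹' K' := fun t ht =>
      (interior_subset (hbefore t ht) : p t ∈ K')
    have hcl := closure_minimal hsub (hK'.isClosed.preimage p.continuous)
    rw [closure_Iio' (a := t₀) ⟨0, ht₀pos⟩] at hcl
    exact fun t ht => hcl ht
  refine ⟨p t₀, fun h => ht₀ (hKK' h), ?_⟩
  let α : Path (f.symm^[n] x') (p t₀) := (p.subpath 0 t₀).cast (by simp) rfl
  rw [displacementSum_sub J n α, ENNReal.coe_add]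
  refine (stableNorm_sub_le _ _).trans (add_le_add (hM _ _ α ?_ ?_ ?_) ?_)
  · simpa using hupto 0 ht₀pos.le
  · exact hupto t₀ le_rfl
  · rintro _ ⟨t, rfl⟩
    exact hK'W (hupto _ (Set.Icc.convexComb_le ht₀pos.le t))
  -- The image under `fⁿ` is an initial piece of `τ'`, hence short.
  · rw [arcClass_congr (β := τ'.subpath 0 t₀) fun t => hfp _]
    push_cast
    refine (stableNorm_arcClass_le hγ _).trans ?_
    gcongr
    exact (pathLength_subpath_zero_le _ _).trans hτ'

theorem exists_mem_stableNorm_displacementSum_sub_le {f : S ≃ₜ S} (J : Isotopy f) {b : S}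
    {γ : ∀ x, Path b x} {C : ℝ≥0} (hγ : ∀ x, pathLength (γ x) ≤ C) {z : S}
    (hz : z ∈ fullyEssentialPoints f) {U : Set S} (hU : U ∈ 𝓝 z) :
    ∃ M : ℝ≥0, ∀ (n : ℕ) (x : S), ∃ y ∈ U,
      stableNorm (displacementSum J γ n x - displacementSum J γ n y) ≤ M := by
  obtain ⟨B, hB⟩ := exists_stableNorm_displacement_le hγ J
  -- If `Φ` vanishes identically there is nothing to prove; otherwise a nonzero value of `Φ`, having
  -- finite stable norm, supplies a rectifiable loop with nonzero class.
  by_cases hzero : ∀ x, displacement J γ x = 0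
  · refine ⟨0, fun n x => ⟨z, mem_of_mem_nhds hU, ?_⟩⟩
    simp [displacementSum, birkhoffSum, hzero, stableNorm_zero]
  push Not at hzero
  obtain ⟨x₀, hx₀⟩ := hzero
  obtain ⟨a, τ, hτfin, hτ⟩ :=
    exists_loopClass_ne_zero hx₀ (ne_top_of_le_ne_top ENNReal.coe_ne_top (hB x₀))
  obtain ⟨W, hW, hcover, hhom⟩ := hz (interior U) (interior_mem_nhds.2 hU)
  have hloop : ∀ (x : S) (α : Path x x), range α ⊆ W → opClass α = 0 := fun x α hα =>
    (opClass_eq_of_homotopic (hhom x α hα)).trans (opClass_refl x)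
  have hopen : ∀ k : ℤ, IsOpen ((f ^ k) '' interior U) := fun k =>
    (f ^ k).isOpenMap _ isOpen_interior
  obtain ⟨T, hT⟩ := hW.isClosed_compl.isCompact.elim_finite_subcover _ hopen
    (by rw [compl_subset_comm]; exact hcover)
  let K : Set S := (⋃ k ∈ T, (f ^ k) '' interior U)ᶜ
  have hK : IsCompact K := (isOpen_biUnion fun k _ => hopen k).isClosed_compl.isCompact
  obtain ⟨M, hM⟩ := exists_stableNorm_displacementSum_sub_le J hγ hτfin hτ hW hK
    (compl_subset_comm.1 hT) hloop
  choose N hN using fun k => exists_stableNorm_displacementSum_zpow_sub_le hB k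
  refine ⟨M + ∑ k ∈ T, N k, fun n x => ?_⟩
  obtain ⟨w, hw, hxw⟩ := hM n x
  rw [notMem_compl_iff] at hw
  obtain ⟨k, hk, y, hy, rfl⟩ := mem_iUnion₂.1 hw
  refine ⟨y, interior_subset hy, ?_⟩
  rw [← sub_add_sub_cancel _ (displacementSum J γ n ((f ^ k) y)), ENNReal.coe_add]
  refine (stableNorm_add_le _ _).trans (add_le_add hxw ((hN k n y).trans ?_))
  exact_mod_cast Finset.single_le_sum (fun i _ => zero_le) hk

end RotationSets

end SurfaceRotation

end

theorem mainTheorem10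
    {S : Type u} [MetricSpace S] [CompactSpace S] [ConnectedSpace S]
    [ChartedSpace (EuclideanSpace ℝ (Fin 2)) S] [IsManifold (𝓡 2) ∞ S]
    [RiemannianBundle (fun x : S => TangentSpace (𝓡 2) x)]
    [IsContMDiffRiemannianBundle (𝓡 2) ∞ (EuclideanSpace ℝ (Fin 2))
      (fun x : S => TangentSpace (𝓡 2) x)]
    [IsRiemannianManifold (𝓡 2) S]
    (hor : SurfaceRotation.IsOrientable S)
    (g : ℕ) (hg : 1 < g) (hS : SurfaceRotation.HasGenus S g)
    (f : S ≃ₜ S) (J : SurfaceRotation.Isotopy f)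
    (b : S) (γ : ∀ x : S, Path b x) (C : ℝ≥0)
    (hγ : ∀ x, SurfaceRotation.pathLength (γ x) ≤ C)
    (z : S) (hz : z ∈ SurfaceRotation.fullyEssentialPoints f)
    (U : Set S) (hU : U ∈ 𝓝 z) :
    (∃ r : ℝ, 0 < r ∧ ∀ n : ℕ,
      {v | ∃ x : S, v = SurfaceRotation.displacementSum J γ n x} ⊆
        SurfaceRotation.homologyBall r
          {v | ∃ y ∈ U, v = SurfaceRotation.displacementSum J γ n y}) ∧
    SurfaceRotation.rotationSet J γ U = SurfaceRotation.rotationSet J γ Set.univ := by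
  obtain ⟨M, hM⟩ := SurfaceRotation.exists_mem_stableNorm_displacementSum_sub_le J hγ hz hU
  -- The ball is defined by a strict inequality, hence `M + 1`.
  refine ⟨⟨M + 1, by positivity, fun n => ?_⟩, SurfaceRotation.rotationSet_eq_univ hM⟩
  rintro _ ⟨x, rfl⟩
  obtain ⟨y, hy, hxy⟩ := hM n x
  refine ⟨_, ⟨y, hy, rfl⟩, ?_⟩
  rw [← neg_sub]
  refine ((SurfaceRotation.stableNorm_neg_le _).trans hxy).trans_lt ?_
  rw [← ENNReal.ofReal_coe_nnreal]
  exact (ENNReal.ofReal_lt_ofReal_iff (by positivity)).2 (lt_add_one _)
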